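/- Let $k$ be a field of characteristic zero, let $V$ be a vector space over $k$, and let $a_1,\ldots,a_n$ be nonzero linear functions on $V$ (not necessarily distinct) that span $V^*$; in particular, $V$ is finite-dimensional. Let $I\subset k[u_1,\ldots,u_n]$ be the kernel of the $k$-algebra homomorphism from $k[u_1,\ldots,u_n]$ to the field $k(V)=\operatorname{Frac}(\operatorname{Sym}(V^*))$ of rational functions on $V$ that takes $u_i$ to $a_i^{-1}$, and let $OT := k[u_1,\ldots,u_n]/I$ be the Orlik–Terao algebra. Regard $OT$ as an algebra over $\operatorname{Sym}(V)$ via the $k$-algebra homomorphism $\operatorname{Sym}(V)\to k[u_1,\ldots,u_n]$ that takes $v\in V$ to $\sum_{i=1}^n a_i(v)u_i$, followed by the quotient map. For $S\subset\{1,\ldots,n\}$ let $u_S:=\prod_{i\in S}u_i$, and call $S$ independent if the only constants $\eta_i\in k$ $(i\in S)$ with $\sum_{i\in S}\eta_i a_i=0$ are $\eta_i=0$ for all $i\in S$. Then $OT$ is spanned as a $\operatorname{Sym}(V)$-module by the images of the square-free monomials $u_S$, where $S$ ranges over the independent subsets of $\{1,\ldots,n\}$. -/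

import Mathlib

noncomputable section

namespace OrlikTerao

variable {k V : Type*} [Field k] [AddCommGroup V] [Module k V] {n : ℕ}

variable (k V) in
/-- The field `k(V)` of rational functions on `V`: the fraction field of the ring `Sym(V^*)` of
polynomial functions on `V`. -/
abbrev RationalFunctions : Type _ :=
  FractionRing (SymmetricAlgebra k (Module.Dual k V))

/-- A linear function on `V`, viewed as a rational function on `V`. -/
def toRational (f : Module.Dual k V) : RationalFunctions k V :=
  algebraMap (SymmetricAlgebra k (Module.Dual k V)) (RationalFunctions k V)
    (SymmetricAlgebra.ι k (Module.Dual k V) f)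

/-- The `k`-algebra map `k[u_1, …, u_n] → k(V)` taking `u_i` to `a_i⁻¹`. -/
def reciprocalMap (a : Fin n → Module.Dual k V) :
    MvPolynomial (Fin n) k →ₐ[k] RationalFunctions k V :=
  MvPolynomial.aeval fun i => (toRational (a i))⁻¹

/-- The ideal `I` of `k[u_1, …, u_n]`: the kernel of `u_i ↦ a_i⁻¹`. -/
def relationIdeal (a : Fin n → Module.Dual k V) : Ideal (MvPolynomial (Fin n) k) :=
  RingHom.ker (reciprocalMap a)

/-- The Orlik–Terao algebra `OT = k[u_1, …, u_n] / I`. -/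
def OT (a : Fin n → Module.Dual k V) : Type _ :=
  MvPolynomial (Fin n) k ⧸ relationIdeal a

instance (a : Fin n → Module.Dual k V) : CommRing (OT a) :=
  inferInstanceAs (CommRing (MvPolynomial (Fin n) k ⧸ relationIdeal a))

instance (a : Fin n → Module.Dual k V) : Algebra k (OT a) :=
  inferInstanceAs (Algebra k (MvPolynomial (Fin n) k ⧸ relationIdeal a))

/-- The quotient map `k[u_1, …, u_n] → OT`. -/
def mk (a : Fin n → Module.Dual k V) : MvPolynomial (Fin n) k →ₐ[k] OT a :=
  Ideal.Quotient.mkₐ k (relationIdeal a)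

/-- The linear map `V → k[u_1, …, u_n]`, `v ↦ ∑ i, a_i(v) u_i`. -/
def linearForms (a : Fin n → Module.Dual k V) : V →ₗ[k] MvPolynomial (Fin n) k :=
  ∑ i, (a i).smulRight (MvPolynomial.X i)

/-- The `k`-algebra map `Sym(V) → k[u_1, …, u_n]` extending `v ↦ ∑ i, a_i(v) u_i`. -/
def symMap (a : Fin n → Module.Dual k V) :
    SymmetricAlgebra k V →ₐ[k] MvPolynomial (Fin n) k :=
  SymmetricAlgebra.lift (linearForms a)

/-- The `Sym(V)`-algebra structure on `OT`, through `Sym(V) → k[u_1, …, u_n] → OT`. -/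
instance (a : Fin n → Module.Dual k V) : Algebra (SymmetricAlgebra k V) (OT a) :=
  ((mk a).comp (symMap a)).toRingHom.toAlgebra

/-- The image in `OT` of the square-free monomial `u_S = ∏_{i ∈ S} u_i`. -/
def monomial (a : Fin n → Module.Dual k V) (S : Finset (Fin n)) : OT a :=
  mk a (∏ i ∈ S, MvPolynomial.X i)

end OrlikTerao

end

namespace OrlikTerao

open Finset Submodule

section Abstract

variable {k V A : Type*} [Field k] [AddCommGroup V] [Module k V] {n : ℕ}
  {a : Fin n → Module.Dual k V}

/-! The span of the `u_S` contains 1, so it suffices that multiplication by each `u_j` preserves it.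
If `a_j` is outside the span of `S`, then `u_j u_S` is again such a monomial; if it is inside and `j
∉ S`, a relation among reciprocals rewrites `u_j u_S` through products `u_j u_T` with `j ∈ T` and
`T` independent. The crux is `u_b u_S` with `b ∈ S` (`mul_prod_mem_localSpan`). Averaging the
relations over all `a_j` in the span `W` of `S` expresses `u_S` through local forms of `W` times
`u_{S \ c}` (`card_smul_prod_eq`). By induction on `S`, `u_b u_S` is then a combination of local
forms of `W` times basis monomials of `W`; the induction passes from a hyperplane to `W` by
`localForm_mul_mem_localSpan`. A local form differs from a global one by terms `u_j` with `a_j ∉ W`,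
which only enlarge the independent set. -/

/-- A finite linearly independent family of functionals has a dual family of vectors. -/
lemma exists_dual_vectors {S : Finset (Fin n)} (hS : LinearIndepOn k a (S : Set (Fin n))) :
    ∃ v : Fin n → V, ∀ c ∈ S, ∀ d ∈ S, a d (v c) = if d = c then 1 else 0 := by
  have key : ∀ c, ∃ x : V, c ∈ S → ∀ d ∈ S, a d x = if d = c then 1 else 0 := by
    intro c
    by_cases hc : c ∈ S
    swap
    · exact ⟨0, fun h => absurd h hc⟩
    have hnot : a c ∉ span k (a '' ((S : Set (Fin n)) \ {c})) :=
      (hS.mono Set.sdiff_subset).notMem_span_iff.2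
        ⟨hS.mono (Set.insert_subset hc Set.sdiff_subset), fun h => h.2 rfl⟩
    have hx : ∃ x : V, (∀ d ∈ S, d ≠ c → a d x = 0) ∧ a c x ≠ 0 := by
      by_contra! h
      apply hnot
      have := mem_span_of_iInf_ker_le_ker
        (L := fun d : ((S : Set (Fin n)) \ {c} : Set (Fin n)) => a d) (K := a c) (by
          intro x hx
          simp only [Submodule.mem_iInf, LinearMap.mem_ker] at hx ⊢
          exact h x fun d hd hdc => hx ⟨d, hd, hdc⟩)
      rwa [Set.image_eq_range]
    obtain ⟨x, h0, h1⟩ := hx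
    refine ⟨(a c x)⁻¹ • x, fun _ d hd => ?_⟩
    split_ifs with h
    · subst h; simp [h1]
    · simp [h0 d hd h]
  choose v hv using key
  exact ⟨v, fun c hc => hv c hc⟩

lemma eq_sum_dual_vectors {S : Finset (Fin n)} {v : Fin n → V}
    (hv : ∀ c ∈ S, ∀ d ∈ S, a d (v c) = if d = c then 1 else 0) {f : Module.Dual k V}
    (hf : f ∈ span k (a '' (S : Set (Fin n)))) : f = ∑ c ∈ S, f (v c) • a c := by
  induction hf using Submodule.span_induction with
  | mem x hx =>
    obtain ⟨d, hd, rfl⟩ := hx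
    rw [Finset.sum_congr rfl fun c hc => by rw [hv c hc d hd]]
    simp [ite_smul, Finset.mem_coe.1 hd]
  | zero => simp
  | add x y _ _ hx hy =>
    conv_lhs => rw [hx, hy]
    simp [add_smul, Finset.sum_add_distrib]
  | smul r x _ hx =>
    conv_lhs => rw [hx]
    simp [Finset.smul_sum, mul_smul]

variable [CommRing A] [Algebra k A] {u : Fin n → A}

open Classical in
/-- The sum `∑ a_j(v) u_j` over those `j` with `a_j` in a subspace `W` of `V^*`. -/
noncomputable def localForm (a : Fin n → Module.Dual k V) (u : Fin n → A) (W : Submodule k (Module.Dual k V))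
    (v : V) : A :=
  ∑ j with a j ∈ W, a j v • u j

/-- The `k`-span of the products of the local linear forms of `W` with the monomials `u_S`,
for `S` indexing a basis of `W`. -/
noncomputable def localSpan (a : Fin n → Module.Dual k V) (u : Fin n → A) (W : Submodule k (Module.Dual k V)) :
    Submodule k A :=
  span k {x | ∃ (v : V) (S : Finset (Fin n)), LinearIndepOn k a (S : Set (Fin n)) ∧
    span k (a '' (S : Set (Fin n))) = W ∧ x = localForm a u W v * ∏ i ∈ S, u i}

/-- The relations among the `u_i` that hold for reciprocals of the `a_i`. -/
def ReciprocalRelations (a : Fin n → Module.Dual k V) (u : Fin n → A) : Prop :=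
  ∀ (S : Finset (Fin n)) (j : Fin n) (f : Fin n → k), a j = ∑ c ∈ S, f c • a c →
    ∏ i ∈ S, u i = u j * ∑ c ∈ S, f c • ∏ i ∈ S.erase c, u i

-- Each `a_j` in the span gives one relation for `u_S`, with coefficients `a_j(v_c)`. Adding them up
-- over `j` assembles, for each `c`, the local form at `v_c`.
open Classical in
lemma card_smul_prod_eq (hrel : ReciprocalRelations a u) {S : Finset (Fin n)} {v : Fin n → V}
    (hv : ∀ c ∈ S, ∀ d ∈ S, a d (v c) = if d = c then 1 else 0) :
    (#{j | a j ∈ span k (a '' (S : Set (Fin n)))} : k) • ∏ i ∈ S, u i =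
      ∑ c ∈ S, localForm a u (span k (a '' (S : Set (Fin n)))) (v c) * ∏ i ∈ S.erase c, u i := by
  simp only [localForm, Finset.sum_mul]
  rw [Finset.sum_comm, Nat.cast_smul_eq_nsmul, ← Finset.sum_const]
  refine Finset.sum_congr rfl fun j hj => ?_
  rw [hrel S j (fun c => a j (v c)) (eq_sum_dual_vectors hv (Finset.mem_filter.1 hj).2),
    Finset.mul_sum]
  refine Finset.sum_congr rfl fun c _ => ?_
  rw [mul_smul_comm, smul_mul_assoc]

/-- Adjoining to a basis of a hyperplane `W'` of `W` an element of `W` outside of `W'`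
yields a basis of `W`. -/
lemma span_insert_eq_of_notMem {W' : Submodule k (Module.Dual k V)} {c j : Fin n}
    {B : Finset (Fin n)} (hB : LinearIndepOn k a (B : Set (Fin n)))
    (hBW : span k (a '' (B : Set (Fin n))) = W') (hj : a j ∈ span k {a c} ⊔ W')
    (hj' : a j ∉ W') :
    j ∉ B ∧ LinearIndepOn k a ((insert j B : Finset (Fin n)) : Set (Fin n)) ∧
      span k (a '' ((insert j B : Finset (Fin n)) : Set (Fin n))) = span k {a c} ⊔ W' := by
  subst hBW
  have hjB : j ∉ B := fun h => hj' (subset_span ⟨j, h, rfl⟩)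
  refine ⟨hjB, ?_, ?_⟩
  · rw [Finset.coe_insert]
    exact hB.insert hj'
  · rw [Finset.coe_insert, Set.image_insert_eq, span_insert]
    refine le_antisymm (sup_le ((span_singleton_le_iff_mem _ _).2 hj) le_sup_right)
      (sup_le ((span_singleton_le_iff_mem _ _).2 ?_) le_sup_right)
    rw [← span_insert] at hj ⊢
    exact mem_span_insert_exchange hj hj'

/-- Since `v` kills `W'`, only indices `j` with `a_j ∈ W \ W'` contribute to the form of `W` at `v`,
and each such `u_j` extends a basis monomial of `W'` to one of `W`. -/
lemma localForm_mul_mem_localSpan {W' : Submodule k (Module.Dual k V)} {c : Fin n} {v : V}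
    (hv : ∀ f ∈ W', f v = 0) {x : A} (hx : x ∈ localSpan a u W') :
    localForm a u (span k {a c} ⊔ W') v * x ∈ localSpan a u (span k {a c} ⊔ W') := by
  classical
  set W := span k {a c} ⊔ W' with hW
  induction hx using Submodule.span_induction with
  | zero => simp
  | add x y _ _ hx hy => rw [mul_add]; exact add_mem hx hy
  | smul r x _ hx => rw [mul_smul_comm]; exact Submodule.smul_mem _ _ hx
  | mem x hx =>
    obtain ⟨w, B, hB, hBW, rfl⟩ := hx
    have hsplit : ∀ y : V, localForm a u W y =
        localForm a u W' y + ∑ j with a j ∈ W ∧ a j ∉ W', a j y • u j := by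
      intro y
      rw [localForm, localForm, ← Finset.sum_filter_add_sum_filter_not
        (Finset.univ.filter fun j => a j ∈ W) (fun j => a j ∈ W'), Finset.filter_filter,
        Finset.filter_filter]
      congr 2
      ext j
      simp only [Finset.mem_filter, Finset.mem_univ, true_and]
      exact ⟨fun h => h.2, fun h => ⟨le_sup_right (a := span k {a c}) h, h⟩⟩
    have hmem : ∀ (y : V) (j : Fin n), a j ∈ W ∧ a j ∉ W' →
        localForm a u W y * (u j * ∏ i ∈ B, u i) ∈ localSpan a u W := by
      intro y j hj
      obtain ⟨h1, h2, h3⟩ := span_insert_eq_of_notMem hB hBW hj.1 hj.2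
      exact subset_span ⟨y, insert j B, h2, h3, by rw [Finset.prod_insert h1]⟩
    have hsum : ∀ y z : V, localForm a u W y *
        ((∑ j with a j ∈ W ∧ a j ∉ W', a j z • u j) * ∏ i ∈ B, u i) ∈ localSpan a u W := by
      intro y z
      rw [Finset.sum_mul, Finset.mul_sum]
      refine sum_mem fun j hj => ?_
      rw [smul_mul_assoc, mul_smul_comm]
      exact Submodule.smul_mem _ _ (hmem y j (Finset.mem_filter.1 hj).2)
    have hzero : localForm a u W' v = 0 :=
      Finset.sum_eq_zero fun j hj => by rw [hv _ (Finset.mem_filter.1 hj).2, zero_smul]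
    have h1 := hsum w v
    have h2 := hsum v w
    have hv' := hsplit v
    rw [hzero, zero_add] at hv'
    rw [← hv'] at h1
    -- Writing `L` and `L'` for the forms of `W` and `W'`, and `R = L - L'`: as `L v = R v`, one has
    -- `L v * L' w = L w * R v - L v * R w`.
    convert sub_mem h1 h2 using 1
    rw [hsplit w]
    ring

/-- A monomial `u_b u_S` with `S` independent and `b ∈ S` is generated in degree `#S`. -/
lemma mul_prod_mem_localSpan [CharZero k] (hrel : ReciprocalRelations a u)
    (S : Finset (Fin n)) (hS : LinearIndepOn k a (S : Set (Fin n))) {b : Fin n} (hb : b ∈ S) :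
    u b * ∏ i ∈ S, u i ∈ localSpan a u (span k (a '' (S : Set (Fin n)))) := by
  classical
  induction S using Finset.strongInduction with
  | H S ih =>
    obtain ⟨v, hv⟩ := exists_dual_vectors hS
    set W := span k (a '' (S : Set (Fin n))) with hW
    -- Characteristic zero enters here: the number of relations averaged must be invertible.
    have hcard : (#{j | a j ∈ W} : k) ≠ 0 := by
      rw [Nat.cast_ne_zero, Finset.card_ne_zero]
      exact ⟨b, Finset.mem_filter.2 ⟨Finset.mem_univ _, subset_span ⟨b, hb, rfl⟩⟩⟩
    rw [← Submodule.smul_mem_iff _ hcard, ← mul_smul_comm, card_smul_prod_eq hrel hv,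
      Finset.mul_sum]
    refine sum_mem fun c hc => ?_
    rw [mul_left_comm]
    by_cases hcb : c = b
    · subst hcb
      rw [Finset.mul_prod_erase S u hc]
      exact subset_span ⟨v c, S, hS, rfl, rfl⟩
    · have hbe : b ∈ S.erase c := Finset.mem_erase.2 ⟨Ne.symm hcb, hb⟩
      have hWc : W = span k {a c} ⊔ span k (a '' ((S.erase c : Finset (Fin n)) : Set (Fin n))) := by
        rw [← span_insert, ← Set.image_insert_eq, ← Finset.coe_insert, Finset.insert_erase hc]
      have := ih (S.erase c) (Finset.erase_ssubset hc)
        (hS.mono (Finset.coe_subset.2 (Finset.erase_subset c S))) hbe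
      rw [← hW, hWc]
      refine localForm_mul_mem_localSpan (fun f hf => ?_) this
      induction hf using Submodule.span_induction with
      | mem x hx =>
        obtain ⟨d, hd, rfl⟩ := hx
        have hd := Finset.mem_erase.1 (Finset.mem_coe.1 hd)
        rw [hv c hc d hd.2, if_neg hd.1]
      | zero => rfl
      | add x y _ _ hx hy => rw [LinearMap.add_apply, hx, hy, add_zero]
      | smul r x _ hx => rw [LinearMap.smul_apply, hx, smul_zero]

/-- A subspace that contains all `u_S` with `S` independent and is stable under the global linear
forms `∑ i, a_i(v) u_i` contains all products `u_j u_S` with `S` independent. -/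
lemma mul_prod_mem [CharZero k] (hrel : ReciprocalRelations a u) {M : Submodule k A}
    (hM : ∀ S : Finset (Fin n), LinearIndepOn k a (S : Set (Fin n)) → ∏ i ∈ S, u i ∈ M)
    (hform : ∀ (v : V), ∀ x ∈ M, (∑ i, a i v • u i) * x ∈ M)
    {S : Finset (Fin n)} (hS : LinearIndepOn k a (S : Set (Fin n))) (j : Fin n) :
    u j * ∏ i ∈ S, u i ∈ M := by
  classical
  have hout : ∀ (T : Finset (Fin n)) (j : Fin n), LinearIndepOn k a (T : Set (Fin n)) →
      a j ∉ span k (a '' (T : Set (Fin n))) → u j * ∏ i ∈ T, u i ∈ M := by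
    intro T j hT hj
    have hjT : j ∉ T := fun h => hj (subset_span ⟨j, h, rfl⟩)
    rw [← Finset.prod_insert hjT]
    refine hM _ ?_
    rw [Finset.coe_insert]
    exact hT.insert hj
  have hlocal : ∀ W, localSpan a u W ≤ M := by
    intro W
    refine span_le.2 ?_
    rintro _ ⟨v, T, hT, rfl, rfl⟩
    -- The local form is the global form minus the terms with `a_j` outside the span of `T`.
    have h := Finset.sum_filter_add_sum_filter_not Finset.univ
      (fun j => a j ∈ span k (a '' (T : Set (Fin n)))) (fun j => a j v • u j)
    rw [SetLike.mem_coe, localForm, eq_sub_of_add_eq h, sub_mul]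
    refine sub_mem (hform v _ (hM T hT)) ?_
    rw [Finset.sum_mul]
    refine sum_mem fun j hj => ?_
    rw [smul_mul_assoc]
    exact Submodule.smul_mem _ _ (hout T j hT (Finset.mem_filter.1 hj).2)
  have hin : ∀ (T : Finset (Fin n)), LinearIndepOn k a (T : Set (Fin n)) → ∀ b ∈ T,
      u b * ∏ i ∈ T, u i ∈ M := fun T hT b hb =>
    hlocal _ (mul_prod_mem_localSpan hrel T hT hb)
  by_cases hj : a j ∈ span k (a '' (S : Set (Fin n)))
  swap
  · exact hout S j hS hj
  by_cases hjS : j ∈ S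
  · exact hin S hS j hjS
  obtain ⟨v, hv⟩ := exists_dual_vectors hS
  have hsum := eq_sum_dual_vectors hv hj
  -- This produces `u_j ^ 2 u_{S \ c}`, that is, `u_j u_T` with `T = (S \ c) ∪ {j}`.
  rw [hrel S j _ hsum, Finset.mul_sum, Finset.mul_sum]
  refine sum_mem fun c hc => ?_
  rw [mul_smul_comm, mul_smul_comm]
  by_cases h0 : a j (v c) = 0
  · rw [h0, zero_smul]; exact zero_mem _
  refine Submodule.smul_mem _ _ ?_
  have hje : j ∉ S.erase c := fun h => hjS (Finset.mem_of_mem_erase h)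
  rw [← Finset.prod_insert hje]
  refine hin _ ?_ j (Finset.mem_insert_self _ _)
  rw [Finset.coe_insert]
  -- Evaluation at `v c` kills the span of `S \ c` but not `a j`, so the exchange keeps
  -- independence.
  refine (hS.mono (Finset.coe_subset.2 (Finset.erase_subset c S))).insert fun hmem => h0 ?_
  have hker : span k (a '' ((S.erase c : Finset (Fin n)) : Set (Fin n))) ≤
      LinearMap.ker (Module.Dual.eval k V (v c)) := by
    refine span_le.2 ?_
    rintro _ ⟨d, hd, rfl⟩
    have hd := Finset.mem_erase.1 (Finset.mem_coe.1 hd)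
    simp [hv c hc d hd.2, hd.1]
  exact hker hmem

end Abstract

/-! ### The reciprocal relations in the Orlik–Terao algebra -/

variable {k V : Type*} [Field k] [AddCommGroup V] [Module k V] {n : ℕ}

lemma ι_injective {W : Type*} [AddCommGroup W] [Module k W] :
    Function.Injective (SymmetricAlgebra.ι k W) := by
  rw [← LinearMap.ker_eq_bot, LinearMap.ker_eq_bot']
  intro x hx
  by_contra hne
  obtain ⟨f, hf⟩ := Module.Projective.exists_dual_eq_one k hne
  have h := congrArg (SymmetricAlgebra.lift (A := k) f) hx
  rw [SymmetricAlgebra.lift_ι_apply, hf, map_zero] at h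
  exact one_ne_zero h

lemma toRational_ne_zero {f : Module.Dual k V} (hf : f ≠ 0) : toRational f ≠ 0 := by
  rw [toRational, ne_eq, FaithfulSMul.algebraMap_eq_zero_iff, ← ne_eq]
  exact (map_ne_zero_iff _ ι_injective).2 hf

lemma toRational_mul_inv {f : Module.Dual k V} (hf : f ≠ 0) :
    toRational f * (toRational f)⁻¹ = 1 :=
  OreLocalization.mul_inv_cancel _ (toRational_ne_zero hf)

lemma toRational_sum_smul (a : Fin n → Module.Dual k V) (S : Finset (Fin n)) (f : Fin n → k) :
    toRational (∑ c ∈ S, f c • a c) = ∑ c ∈ S, f c • toRational (a c) := by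
  simp [toRational, Algebra.smul_def, ← IsScalarTower.algebraMap_apply]

/-- This is the linear relation for `a_j` multiplied by the product of the inverses over `S` and
divided by `a_j`. -/
lemma reciprocalRelations_inv {a : Fin n → Module.Dual k V} (ha : ∀ i, a i ≠ 0) :
    ReciprocalRelations a fun i => (toRational (a i))⁻¹ := by
  intro S j f h
  have hj := congrArg toRational h
  rw [toRational_sum_smul] at hj
  have hs : ∑ c ∈ S, f c • ∏ i ∈ S.erase c, (toRational (a i))⁻¹ =
      toRational (a j) * ∏ i ∈ S, (toRational (a i))⁻¹ := by
    rw [hj, Finset.sum_mul]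
    refine Finset.sum_congr rfl fun c hc => ?_
    rw [← Finset.mul_prod_erase S _ hc, smul_mul_assoc, ← mul_assoc,
      toRational_mul_inv (ha c), one_mul]
  simp only [hs]
  rw [← mul_assoc, mul_comm _ (toRational (a j)), toRational_mul_inv (ha j), one_mul]

lemma reciprocalRelations_mk {a : Fin n → Module.Dual k V} (ha : ∀ i, a i ≠ 0) :
    ReciprocalRelations a fun i => mk a (MvPolynomial.X i) := by
  intro S j f h
  have hp := reciprocalRelations_inv ha S j f h
  have : mk a (∏ i ∈ S, MvPolynomial.X i) =
      mk a (MvPolynomial.X j * ∑ c ∈ S, f c • ∏ i ∈ S.erase c, MvPolynomial.X i) := by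
    refine Ideal.Quotient.eq.2 ?_
    rw [relationIdeal, RingHom.mem_ker, map_sub, sub_eq_zero]
    simpa [reciprocalMap] using hp
  simpa using this

lemma ι_smul (a : Fin n → Module.Dual k V) (v : V) (x : OT a) :
    SymmetricAlgebra.ι k V v • x = (∑ i, a i v • mk a (MvPolynomial.X i)) * x := by
  have : SymmetricAlgebra.ι k V v • x =
      mk a (symMap a (SymmetricAlgebra.ι k V v)) * x := rfl
  rw [this, symMap, SymmetricAlgebra.lift_ι_apply]
  simp [linearForms]

lemma algebraMap_smul_eq (a : Fin n → Module.Dual k V) (r : k) (x : OT a) :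
    algebraMap k (SymmetricAlgebra k V) r • x = r • x := by
  have : algebraMap k (SymmetricAlgebra k V) r • x =
      mk a (symMap a (algebraMap k (SymmetricAlgebra k V) r)) * x := rfl
  rw [this, AlgHom.commutes, AlgHom.commutes, Algebra.smul_def]

end OrlikTerao

theorem theoremA3 {k V : Type*} [Field k] [CharZero k] [AddCommGroup V] [Module k V]
    {n : ℕ} (a : Fin n → Module.Dual k V) (ha : ∀ i, a i ≠ 0)
    (hspan : Submodule.span k (Set.range a) = ⊤) :
    Submodule.span (SymmetricAlgebra k V)
      {x : OrlikTerao.OT a |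
        ∃ S : Finset (Fin n), LinearIndepOn k a (S : Set (Fin n)) ∧ x = OrlikTerao.monomial a S} =
      ⊤ := by
  open OrlikTerao in
  set N := Submodule.span (SymmetricAlgebra k V)
    {x : OT a | ∃ S : Finset (Fin n), LinearIndepOn k a (S : Set (Fin n)) ∧ x = monomial a S}
    with hN
  let M : Submodule k (OT a) :=
    { N.toAddSubmonoid with
      smul_mem' := fun r x hx => by
        rw [← algebraMap_smul_eq]
        exact N.smul_mem _ hx }
  have hMN : ∀ x, x ∈ M ↔ x ∈ N := fun _ => Iff.rfl
  have hmon : ∀ S : Finset (Fin n), LinearIndepOn k a (S : Set (Fin n)) →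
      ∏ i ∈ S, mk a (MvPolynomial.X i) ∈ M := fun S hS =>
    Submodule.subset_span ⟨S, hS, by rw [monomial, map_prod]⟩
  have hstep : ∀ (j : Fin n), ∀ x ∈ N, mk a (MvPolynomial.X j) * x ∈ N := by
    intro j x hx
    induction hx using Submodule.span_induction with
    | mem x hx =>
      obtain ⟨S, hS, rfl⟩ := hx
      rw [monomial, map_prod]
      exact mul_prod_mem (M := M) (reciprocalRelations_mk ha) hmon
        (fun v x hx => by rw [← ι_smul]; exact N.smul_mem _ hx) hS j
    | zero => rw [mul_zero]; exact N.zero_mem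
    | add x y _ _ hx hy => rw [mul_add]; exact N.add_mem hx hy
    | smul r x _ hx => rw [mul_smul_comm]; exact N.smul_mem _ hx
  rw [eq_top_iff]
  rintro x -
  obtain ⟨p, rfl⟩ := Ideal.Quotient.mk_surjective x
  change mk a p ∈ M
  induction p using MvPolynomial.induction_on with
  | C r =>
    have h1 : (1 : OT a) ∈ M := by simpa using hmon ∅ (by simp)
    have : mk a (MvPolynomial.C r) = r • 1 := by
      rw [← MvPolynomial.algebraMap_eq, AlgHom.commutes, Algebra.algebraMap_eq_smul_one]
    rw [this]
    exact M.smul_mem r h1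
  | add p q hp hq => rw [map_add]; exact M.add_mem hp hq
  | mul_X p j hp => rw [map_mul, mul_comm]; exact hstep j _ hp
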